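/- Let $\mathcal A$ be a unital complex Banach algebra and $\varphi:\mathcal A\to\mathbb C$ a continuous linear functional with $\varphi(1)=1$. For $a,b\in\mathcal A$ and $t,s\in\mathbb C$ near $0$ put $$h_a(t)=\varphi((1-ta)^{-1}),\qquad \psi_a(t)=h_a(t)-1,\qquad H_{a,b}(t,s)=\varphi\big((1-ta)^{-1}(1-sb)^{-1}\big).$$ If $\varphi(a)\neq0$, then $\psi_a(0)=0$ and $\psi_a'(0)=\varphi(a)\ne 0$, and $\mathcal X_a$ denotes the inverse function of $\psi_a$ near $0$, with $\mathcal X_a(0)=0$. If $\varphi(a)\neq0$ and $\varphi(b)\neq 0$, the two-variable partial bi-free $S$-transform of the two-faced pair $(a,b)$ (left variable $a$, right variable $b$) is, for $(z,w)\in(\mathbb C\setminus\{0\})^2$ near $(0,0)$, $$S_{a,b}(z,w)=\frac{z+1}{z}\,\frac{w+1}{w}\left(1-\frac{1+z+w}{H_{a,b}(\mathcal X_a(z),\mathcal X_b(w))}\right).$$ Two two-faced pairs $(a_1,b_1)$, $(a_2,b_2)$ in $(\mathcal A,\varphi)$ are bi-free if there are complex vector spaces $X_k=\mathbb C\xi_k\oplus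 X_k^\circ$ and linear operators $T_k,S_k$ on $X_k$ ($k=1,2$) such that, for every noncommutative polynomial $P$ in four variables, $\varphi(P(a_1,a_2,b_1,b_2))$ is the coefficient of $\xi$ in $P(\lambda_1(T_1),\lambda_2(T_2),\rho_1(S_1),\rho_2(S_2))\,\xi$. Here $\lambda_k$ and $\rho_k$ are the left and right representations of the linear operators on $X_k$ on the free product $X=\mathbb C\xi\oplus\bigoplus_{n\ge1}\bigoplus_{k_1\ne k_2\neq\cdots\ne k_n}X_{k_1}^\circ\otimes\cdots\otimes X_{k_n}^\circ$; that is, $\lambda_k(T)$ acts as $T\otimes 1$ under the canonical isomorphism of $X$ with $X_k\otimes X(\ell,k)$, and $\rho_k(T)$ acts as $1\otimes T$ under that with $X(r,k)\otimes X_k$, where $X(\ell,k)$ and $X(r,k)$ are the sums of $\mathbb C\xi$ and the summands with $k_1\ne k$, respectively $k_n\neq k$. **Theorem 2.1.** Let $(a_1,b_1)$ and $(a_2,b_2)$ be a bi-free pair of two-faced pairs in $(\mathcal A,\varphi)$ with $\varphi(a_1),\varphi(a_2),\varphi(b_1),\varphi(b_2)$ all nonzero. Then $\varphi(a_1a_2)\ne0$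 and $\varphi(b_1b_2)\neq0$, so that $S_{a_1a_2,b_1b_2}$ is defined, and $$S_{a_1a_2,b_1b_2}(z,w)=S_{a_1,b_1}(z,w)\,S_{a_2,b_2}(z,w)$$ for all $(z,w)\in(\mathbb C\setminus\{0\})^2$ sufficiently close to $(0,0)$. -/

import Mathlib

open Filter Topology
open scoped DirectSum

universe u v w

namespace BiFree

noncomputable section

/-! ### Free products of vector spaces with a specified state vector

A vector space with a specified state vector is a triple `(X, X°, ξ)` with `X = ℂ ξ ⊕ X°`. Such a
triple is written here as `X = ℂ × V`, `ξ = (1, 0)`, `X° = V`. The free product of the family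
`ℂ × V k` is `ℂ ξ ⊕ ⨁ V k₁ ⊗ ⋯ ⊗ V kₙ`, the sum being over `n ≥ 1` and `k₁ ≠ k₂ ≠ ⋯ ≠ kₙ`; it is
realised inside the tensor algebra of `⨁ k, V k`, with `ξ = 1`. -/

section FreeProduct


variable {ι : Type u} [DecidableEq ι] (V : ι → Type v)
  [∀ k, AddCommGroup (V k)] [∀ k, Module ℂ (V k)]

/-- The full tensor algebra of `⨁ k, V k`. -/
abbrev Tens : Type (max u v) := TensorAlgebra ℂ (⨁ k, V k)

variable {V}

/-- A vector of `V k`, as a tensor of degree one. -/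
def letter (k : ι) : V k →ₗ[ℂ] Tens V :=
  TensorAlgebra.ι ℂ ∘ₗ DirectSum.lof ℂ ι V k

/-- The pure tensor `x₁ ⊗ ⋯ ⊗ xₙ` with `xᵢ ∈ V kᵢ`; the empty word gives `ξ = 1`. -/
def word (l : List (Σ k, V k)) : Tens V := (l.map fun x => letter x.1 x.2).prod

/-- `k₁ ≠ k₂ ≠ ⋯ ≠ kₙ` for the indices of the letters. -/
def Alternating (l : List (Σ k, V k)) : Prop := l.IsChain fun x y => x.1 ≠ y.1

variable (V)

/-- The free product of the vector spaces with state vector `ℂ × V k`. -/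
def freeProd : Submodule ℂ (Tens V) := Submodule.span ℂ {w | ∃ l, Alternating l ∧ w = word l}

/-- The state vector of the free product. -/
def stateVector : freeProd V := ⟨1, Submodule.subset_span ⟨[], List.isChain_nil, rfl⟩⟩

/-- The coefficient of the state vector: it is `1` on `ξ` and `0` on tensors of positive degree. -/
def vacuumCoeff : freeProd V →ₗ[ℂ] ℂ :=
  (TensorAlgebra.algebraMapInv (R := ℂ) (M := ⨁ k, V k)).toLinearMap ∘ₗ (freeProd V).subtype

variable {V}

/-- The inclusion of `ℂ × V k` into the tensors, `(1, 0) ↦ ξ = 1` and `(0, x) ↦ x`. -/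
def incl (k : ι) : (ℂ × V k) →ₗ[ℂ] Tens V :=
  LinearMap.coprod (Algebra.linearMap ℂ (Tens V)) (letter k)

/-- One step of the recursion on the left. -/
def stepLeft (L : (⨁ k, V k) →ₗ[ℂ] Tens V) :
    (⨁ k, V k) →ₗ[ℂ] Module.End ℂ (Tens V × Tens V) where
  toFun x := LinearMap.prod
    (LinearMap.mulLeft ℂ (TensorAlgebra.ι ℂ x) ∘ₗ LinearMap.fst ℂ _ _)
    (LinearMap.mulLeft ℂ (L x) ∘ₗ LinearMap.fst ℂ _ _)
  map_add' x y := by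
    refine LinearMap.ext fun p => Prod.ext ?_ ?_ <;> simp [add_mul]
  map_smul' c x := by
    refine LinearMap.ext fun p => Prod.ext ?_ ?_ <;> simp

/-- One step of the recursion on the right. -/
def stepRight (L : (⨁ k, V k) →ₗ[ℂ] Tens V) :
    (⨁ k, V k) →ₗ[ℂ] (Module.End ℂ (Tens V × Tens V))ᵐᵒᵖ where
  toFun x := MulOpposite.op (LinearMap.prod
    (LinearMap.mulRight ℂ (TensorAlgebra.ι ℂ x) ∘ₗ LinearMap.fst ℂ _ _)
    (LinearMap.mulRight ℂ (L x) ∘ₗ LinearMap.fst ℂ _ _))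
  map_add' x y := by
    refine MulOpposite.unop_injective (LinearMap.ext fun p => Prod.ext ?_ ?_) <;> simp [mul_add]
  map_smul' c x := by
    refine MulOpposite.unop_injective (LinearMap.ext fun p => Prod.ext ?_ ?_) <;> simp

/-- The linear map `f` with `f 1 = c` and `f (x ⊗ v) = L x ⊗ v`
(see `peelLeft_one`, `peelLeft_mul`). -/
def peelLeft (c : Tens V) (L : (⨁ k, V k) →ₗ[ℂ] Tens V) : Module.End ℂ (Tens V) :=
  LinearMap.snd ℂ _ _ ∘ₗ LinearMap.applyₗ ((1 : Tens V), c) ∘ₗ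
    (TensorAlgebra.lift ℂ (stepLeft L)).toLinearMap

/-- The linear map `f` with `f 1 = c` and `f (v ⊗ x) = v ⊗ L x`
(see `peelRight_one`, `peelRight_mul`). -/
def peelRight (c : Tens V) (L : (⨁ k, V k) →ₗ[ℂ] Tens V) : Module.End ℂ (Tens V) :=
  LinearMap.snd ℂ _ _ ∘ₗ LinearMap.applyₗ ((1 : Tens V), c) ∘ₗ
    (MulOpposite.opLinearEquiv ℂ).symm.toLinearMap ∘ₗ
    (TensorAlgebra.lift ℂ (stepRight L)).toLinearMap

theorem peelLeft_one (c : Tens V) (L : (⨁ k, V k) →ₗ[ℂ] Tens V) : peelLeft c L 1 = c := by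
  simp [peelLeft]

theorem peelRight_one (c : Tens V) (L : (⨁ k, V k) →ₗ[ℂ] Tens V) : peelRight c L 1 = c := by
  simp [peelRight]

theorem lift_stepLeft_fst (L : (⨁ k, V k) →ₗ[ℂ] Tens V) (v : Tens V) :
    ∀ p, (TensorAlgebra.lift ℂ (stepLeft L) v p).1 = v * p.1 := by
  induction v using TensorAlgebra.induction with
  | algebraMap r => intro p; simp [Module.algebraMap_end_apply, Algebra.smul_def]
  | ι x => intro p; simp [stepLeft]
  | mul a b ha hb => intro p; simp [ha, hb, mul_assoc]
  | add a b ha hb => intro p; simp [ha, hb, add_mul]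

theorem lift_stepRight_fst (L : (⨁ k, V k) →ₗ[ℂ] Tens V) (v : Tens V) :
    ∀ p, ((TensorAlgebra.lift ℂ (stepRight L) v).unop p).1 = p.1 * v := by
  induction v using TensorAlgebra.induction with
  | algebraMap r =>
    intro p
    simp [MulOpposite.algebraMap_apply, Module.algebraMap_end_apply, Algebra.smul_def,
      Algebra.commutes]
  | ι x => intro p; simp [stepRight]
  | mul a b ha hb => intro p; simp [ha, hb, mul_assoc]
  | add a b ha hb => intro p; simp [ha, hb, mul_add]

theorem peelLeft_mul (c : Tens V) (L : (⨁ k, V k) →ₗ[ℂ] Tens V) (x : ⨁ k, V k) (v : Tens V) :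
    peelLeft c L (TensorAlgebra.ι ℂ x * v) = L x * v := by
  have h := lift_stepLeft_fst L v (1, c)
  simp only [mul_one] at h
  simp only [peelLeft, LinearMap.comp_apply, AlgHom.toLinearMap_apply, map_mul,
    TensorAlgebra.lift_ι_apply, LinearMap.applyₗ_apply_apply, Module.End.mul_apply]
  exact congrArg (L x * ·) h

theorem peelRight_mul (c : Tens V) (L : (⨁ k, V k) →ₗ[ℂ] Tens V) (x : ⨁ k, V k) (v : Tens V) :
    peelRight c L (v * TensorAlgebra.ι ℂ x) = v * L x := by
  have h := lift_stepRight_fst L v (1, c)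
  simp only [one_mul] at h
  simp only [peelRight, LinearMap.comp_apply, AlgHom.toLinearMap_apply, map_mul,
    TensorAlgebra.lift_ι_apply, LinearMap.applyₗ_apply_apply]
  exact congrArg (· * L x) h

/-- The part of a vector of `⨁ k, V k` in `V k`. -/
def part (k : ι) : (⨁ k, V k) →ₗ[ℂ] V k := DirectSum.component ℂ ι V k

/-- The part of a vector of `⨁ k, V k` outside `V k`. -/
def rest (k : ι) : Module.End ℂ (⨁ k, V k) := LinearMap.id - DirectSum.lof ℂ ι V k ∘ₗ part k

/-- The left operator of `T` on tensors: `1 ↦ T ξ`, `x ⊗ v ↦ T x ⊗ v` if `x ∈ V k`, and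
`x ⊗ v ↦ T ξ ⊗ x ⊗ v` if `x ∈ V j` with `j ≠ k`. Here `T y ∈ ℂ × V k` is read as a tensor. -/
def leftTens (k : ι) (T : Module.End ℂ (ℂ × V k)) : Module.End ℂ (Tens V) :=
  peelLeft (incl k (T (1, 0)))
    (incl k ∘ₗ T ∘ₗ LinearMap.inr ℂ ℂ (V k) ∘ₗ part k +
      LinearMap.mulLeft ℂ (incl k (T (1, 0))) ∘ₗ TensorAlgebra.ι ℂ ∘ₗ rest k)

/-- The right operator of `T` on tensors: `1 ↦ T ξ`, `v ⊗ x ↦ v ⊗ T x` if `x ∈ V k`, and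
`v ⊗ x ↦ v ⊗ x ⊗ T ξ` if `x ∈ V j` with `j ≠ k`. Here `T y ∈ ℂ × V k` is read as a tensor. -/
def rightTens (k : ι) (T : Module.End ℂ (ℂ × V k)) : Module.End ℂ (Tens V) :=
  peelRight (incl k (T (1, 0)))
    (incl k ∘ₗ T ∘ₗ LinearMap.inr ℂ ℂ (V k) ∘ₗ part k +
      LinearMap.mulRight ℂ (incl k (T (1, 0))) ∘ₗ TensorAlgebra.ι ℂ ∘ₗ rest k)

/-- The word does not begin with a letter from `V k`. -/
def NotHead (k : ι) (l : List (Σ k, V k)) : Prop := ∀ x ∈ l.head?, x.1 ≠ k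

/-- The word does not end with a letter from `V k`. -/
def NotLast (k : ι) (l : List (Σ k, V k)) : Prop := ∀ x ∈ l.getLast?, x.1 ≠ k

theorem word_cons (x : Σ k, V k) (l : List (Σ k, V k)) :
    word (x :: l) = letter x.1 x.2 * word l := by simp [word]

theorem word_concat (x : Σ k, V k) (l : List (Σ k, V k)) :
    word (l ++ [x]) = word l * letter x.1 x.2 := by simp [word]

theorem incl_apply (k : ι) (y : ℂ × V k) :
    incl k y = algebraMap ℂ (Tens V) y.1 + letter k y.2 := by
  simp [incl]

theorem leftTens_one (k : ι) (T : Module.End ℂ (ℂ × V k)) :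
    leftTens k T 1 = incl k (T (1, 0)) := peelLeft_one _ _

theorem rightTens_one (k : ι) (T : Module.End ℂ (ℂ × V k)) :
    rightTens k T 1 = incl k (T (1, 0)) := peelRight_one _ _

theorem leftTens_same (k : ι) (T : Module.End ℂ (ℂ × V k)) (x : V k) (v : Tens V) :
    leftTens k T (letter k x * v) = incl k (T (0, x)) * v := by
  simp [leftTens, letter, peelLeft_mul, part, rest, DirectSum.component.lof_self]

theorem rightTens_same (k : ι) (T : Module.End ℂ (ℂ × V k)) (x : V k) (v : Tens V) :
    rightTens k T (v * letter k x) = v * incl k (T (0, x)) := by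
  simp [rightTens, letter, peelRight_mul, part, rest, DirectSum.component.lof_self]

theorem part_lof_ne {k j : ι} (h : j ≠ k) (x : V j) :
    part k (DirectSum.lof ℂ ι V j x) = 0 := by
  simp [part, DirectSum.component.of, h]

theorem leftTens_ne {k j : ι} (h : j ≠ k) (T : Module.End ℂ (ℂ × V k)) (x : V j) (v : Tens V) :
    leftTens k T (letter j x * v) = incl k (T (1, 0)) * (letter j x * v) := by
  have h0 : T (0, 0) = 0 := map_zero T
  simp [leftTens, letter, peelLeft_mul, rest, part_lof_ne h, h0, mul_assoc]

theorem rightTens_ne {k j : ι} (h : j ≠ k) (T : Module.End ℂ (ℂ × V k)) (x : V j) (v : Tens V) :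
    rightTens k T (v * letter j x) = v * letter j x * incl k (T (1, 0)) := by
  have h0 : T (0, 0) = 0 := map_zero T
  simp [rightTens, letter, peelRight_mul, rest, part_lof_ne h, h0, mul_assoc]

/-- `λ_k(T) V_k = V_k (T ⊗ 1)`, where `V_k (y ⊗ v) = y v` for `y ∈ ℂ × V k` and `v` in the span of
the words that do not begin with a letter from `V k`. -/
theorem leftTens_incl_mul (k : ι) (T : Module.End ℂ (ℂ × V k)) (y : ℂ × V k)
    (l : List (Σ k, V k)) (hl : NotHead k l) :
    leftTens k T (incl k y * word l) = incl k (T y) * word l := by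
  have h1 : leftTens k T (word l) = incl k (T (1, 0)) * word l := by
    cases l with
    | nil => simpa [word] using leftTens_one k T
    | cons x l => rw [word_cons]; exact leftTens_ne (hl x (by simp)) T _ _
  have hy : T y = y.1 • T (1, 0) + T (0, y.2) := by
    rw [← map_smul, ← map_add]; simp
  rw [incl_apply, add_mul, map_add, leftTens_same, hy, map_add, map_smul, add_mul,
    ← Algebra.smul_def, map_smul, h1, smul_mul_assoc]

/-- `ρ_k(T) W_k = W_k (1 ⊗ T)`, where `W_k (v ⊗ y) = v y` for `y ∈ ℂ × V k` and `v` in the span of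
the words that do not end with a letter from `V k`. -/
theorem rightTens_mul_incl (k : ι) (T : Module.End ℂ (ℂ × V k)) (y : ℂ × V k)
    (l : List (Σ k, V k)) (hl : NotLast k l) :
    rightTens k T (word l * incl k y) = word l * incl k (T y) := by
  have h1 : rightTens k T (word l) = word l * incl k (T (1, 0)) := by
    rcases List.eq_nil_or_concat' l with rfl | ⟨l, x, rfl⟩
    · simpa [word] using rightTens_one k T
    · rw [word_concat]; exact rightTens_ne (hl x (by simp)) T _ _
  have hy : T y = y.1 • T (1, 0) + T (0, y.2) := by
    rw [← map_smul, ← map_add]; simp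
  rw [incl_apply, mul_add, map_add, rightTens_same, hy, map_add, map_smul, mul_add,
    ← Algebra.commutes, ← Algebra.smul_def, map_smul, h1, mul_smul_comm]

theorem incl_mul_word_mem (k : ι) (y : ℂ × V k) (l : List (Σ k, V k)) (hl : Alternating l)
    (hk : NotHead k l) : incl k y * word l ∈ freeProd V := by
  rw [incl_apply, add_mul, ← Algebra.smul_def]
  refine add_mem (Submodule.smul_mem _ _ (Submodule.subset_span ⟨l, hl, rfl⟩))
    (Submodule.subset_span ⟨⟨k, y.2⟩ :: l, ?_, by rw [word_cons]⟩)
  exact List.isChain_cons.2 ⟨fun x hx => (hk x hx).symm, hl⟩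

theorem word_mul_incl_mem (k : ι) (y : ℂ × V k) (l : List (Σ k, V k)) (hl : Alternating l)
    (hk : NotLast k l) : word l * incl k y ∈ freeProd V := by
  rw [incl_apply, mul_add, ← Algebra.commutes, ← Algebra.smul_def]
  refine add_mem (Submodule.smul_mem _ _ (Submodule.subset_span ⟨l, hl, rfl⟩))
    (Submodule.subset_span ⟨l ++ [⟨k, y.2⟩], ?_, by rw [word_concat]⟩)
  refine List.isChain_append.2 ⟨hl, List.isChain_singleton _, ?_⟩
  intro x hx z hz
  simp only [List.head?_cons, Option.mem_def, Option.some.injEq] at hz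
  subst hz
  exact hk x hx

/-- The isomorphism `V_k` hits every word. -/
theorem exists_left (k : ι) (l : List (Σ k, V k)) (hl : Alternating l) :
    ∃ y l', Alternating l' ∧ NotHead k l' ∧ word l = incl k y * word l' := by
  by_cases hk : NotHead k l
  · exact ⟨(1, 0), l, hl, hk, by simp [incl_apply]⟩
  · cases l with
    | nil => exact absurd (by simp [NotHead]) hk
    | cons x l =>
      obtain ⟨j, x⟩ := x
      have hj : j = k := by simpa [NotHead] using hk
      subst hj
      obtain ⟨h1, h2⟩ := List.isChain_cons.1 hl
      exact ⟨(0, x), l, h2, fun z hz => (h1 z hz).symm, by simp [incl_apply, word_cons]⟩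

/-- The isomorphism `W_k` hits every word. -/
theorem exists_right (k : ι) (l : List (Σ k, V k)) (hl : Alternating l) :
    ∃ y l', Alternating l' ∧ NotLast k l' ∧ word l = word l' * incl k y := by
  by_cases hk : NotLast k l
  · exact ⟨(1, 0), l, hl, hk, by simp [incl_apply]⟩
  · rcases List.eq_nil_or_concat' l with rfl | ⟨l, ⟨j, x⟩, rfl⟩
    · exact absurd (by simp [NotLast]) hk
    · have hj : j = k := by simpa [NotLast] using hk
      subst hj
      obtain ⟨h1, -, h2⟩ := List.isChain_append.1 hl
      exact ⟨(0, x), l, h1, fun z hz => h2 z hz ⟨j, x⟩ (by simp), by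
        simp [incl_apply, word_concat]⟩

theorem leftTens_mem (k : ι) (T : Module.End ℂ (ℂ × V k)) :
    ∀ w ∈ freeProd V, leftTens k T w ∈ freeProd V := by
  intro w hw
  induction hw using Submodule.span_induction with
  | mem w h =>
    obtain ⟨l, hl, rfl⟩ := h
    obtain ⟨y, l', h1, h2, h3⟩ := exists_left k l hl
    rw [h3, leftTens_incl_mul k T y l' h2]
    exact incl_mul_word_mem k _ l' h1 h2
  | zero => simp
  | add a b _ _ ha hb => rw [map_add]; exact add_mem ha hb
  | smul c a _ ha => rw [map_smul]; exact Submodule.smul_mem _ _ ha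

theorem rightTens_mem (k : ι) (T : Module.End ℂ (ℂ × V k)) :
    ∀ w ∈ freeProd V, rightTens k T w ∈ freeProd V := by
  intro w hw
  induction hw using Submodule.span_induction with
  | mem w h =>
    obtain ⟨l, hl, rfl⟩ := h
    obtain ⟨y, l', h1, h2, h3⟩ := exists_right k l hl
    rw [h3, rightTens_mul_incl k T y l' h2]
    exact word_mul_incl_mem k _ l' h1 h2
  | zero => simp
  | add a b _ _ ha hb => rw [map_add]; exact add_mem ha hb
  | smul c a _ ha => rw [map_smul]; exact Submodule.smul_mem _ _ ha

/-- The left representation `λ_k` of the operators on `ℂ × V k` on the free product. -/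
def leftOp (k : ι) (T : Module.End ℂ (ℂ × V k)) : Module.End ℂ (freeProd V) :=
  (leftTens k T).restrict (leftTens_mem k T)

/-- The right representation `ρ_k` of the operators on `ℂ × V k` on the free product. -/
def rightOp (k : ι) (T : Module.End ℂ (ℂ × V k)) : Module.End ℂ (freeProd V) :=
  (rightTens k T).restrict (rightTens_mem k T)

end FreeProduct

/-! ### Bi-freeness -/


/-- The joint distribution of variables `x i` with respect to `φ`: the linear functional
`P ↦ φ (P (x))` on noncommutative polynomials. -/
def jointDistribution {I : Type*} {A : Type*} [Ring A] [Algebra ℂ A] (φ : A →ₗ[ℂ] ℂ)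
    (x : I → A) : FreeAlgebra ℂ I →ₗ[ℂ] ℂ :=
  φ ∘ₗ (FreeAlgebra.lift ℂ x).toLinearMap

/-- The functional `T ↦ (coefficient of ξ in T ξ)` on the operators on a free product. -/
def vacuumState {ι : Type u} [DecidableEq ι] (V : ι → Type v)
    [∀ k, AddCommGroup (V k)] [∀ k, Module ℂ (V k)] : Module.End ℂ (freeProd V) →ₗ[ℂ] ℂ :=
  vacuumCoeff V ∘ₗ LinearMap.applyₗ (stateVector V)

/-- The two-faced pairs `(a k, b k)` (left variable `a k`, right variable `b k`) in `(A, φ)` are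
bi-free: there are vector spaces with state vector `ℂ × V k` and operators `T k`, `S k` on them,
such that the variables `a k`, `b k` have the same joint distribution as the operators
`λ_k (T k)`, `ρ_k (S k)` on the free product. -/
def IsBiFree {ι : Type u} [DecidableEq ι] {A : Type w} [Ring A] [Algebra ℂ A]
    (φ : A →ₗ[ℂ] ℂ) (a b : ι → A) : Prop :=
  ∃ (V : ι → Type v) (_ : ∀ k, AddCommGroup (V k)) (_ : ∀ k, Module ℂ (V k))
    (T S : ∀ k, Module.End ℂ (ℂ × V k)),
    jointDistribution φ (Sum.elim a b) =
      jointDistribution (vacuumState V)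
        (Sum.elim (fun k => leftOp k (T k)) (fun k => rightOp k (S k)))

/-! ### The transforms -/

section Transforms

variable {A : Type*} [NormedRing A] [NormedAlgebra ℂ A]

/-- `h_a(t) = φ((1 - t a)⁻¹)`. -/
def hFun (φ : A →L[ℂ] ℂ) (a : A) (t : ℂ) : ℂ := φ (Ring.inverse (1 - t • a))

/-- `ψ_a(t) = h_a(t) - 1`. -/
def psi (φ : A →L[ℂ] ℂ) (a : A) (t : ℂ) : ℂ := hFun φ a t - 1

/-- `H_{a,b}(t,s) = φ((1 - t a)⁻¹ (1 - s b)⁻¹)`. -/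
def HFun (φ : A →L[ℂ] ℂ) (a b : A) (t s : ℂ) : ℂ :=
  φ (Ring.inverse (1 - t • a) * Ring.inverse (1 - s • b))

theorem hasStrictDerivAt_psi [CompleteSpace A] (φ : A →L[ℂ] ℂ) (a : A) :
    HasStrictDerivAt (psi φ a) (φ a) 0 := by
  have h1 : HasStrictDerivAt (fun t : ℂ => (1 : A) - t • a) (-a) 0 := by
    simpa using ((hasStrictDerivAt_id (0 : ℂ)).smul_const a).const_sub (1 : A)
  have h2 : HasStrictFDerivAt (𝕜 := ℂ) Ring.inverse
      (-ContinuousLinearMap.mulLeftRight ℂ A 1 1) ((1 : A) - (0 : ℂ) • a) := by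
    simpa using hasStrictFDerivAt_ringInverse (𝕜 := ℂ) (1 : Aˣ)
  have h3 := φ.hasStrictFDerivAt.comp_hasStrictDerivAt (0 : ℂ) (h2.comp_hasStrictDerivAt (0 : ℂ) h1)
  have h4 : HasStrictDerivAt (hFun φ a) (φ a) 0 := by
    refine HasStrictDerivAt.congr_deriv (f := hFun φ a) h3 ?_
    simp
  exact h4.sub_const 1

open Classical in
/-- `𝒳_a`, the inverse function of `ψ_a` near `0`, with `𝒳_a(0) = 0`; it exists when `φ(a) ≠ 0`, and
is given the value `0` otherwise. -/
def chi [CompleteSpace A] (φ : A →L[ℂ] ℂ) (a : A) : ℂ → ℂ :=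
  if h : φ a ≠ 0 then (hasStrictDerivAt_psi φ a).localInverse (psi φ a) (φ a) 0 h else 0

/-- The 2-variables partial bi-free S-transform (for `φ(a) ≠ 0`, `φ(b) ≠ 0`). -/
def partialS [CompleteSpace A] (φ : A →L[ℂ] ℂ) (a b : A) (z w : ℂ) : ℂ :=
  (z + 1) / z * ((w + 1) / w) * (1 - (1 + z + w) / HFun φ a b (chi φ a z) (chi φ b w))

end Transforms

end

end BiFree

/-!
Write `x_k(z) = (1 + z)⁻¹ (1 - 𝒳_{a_k}(z) a_k)⁻¹ - 1` and define `y_k(w)` from `b_k` in the same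
way. These elements are centred, and they lie in the closed algebras generated by `a_k` and `b_k`,
so they inherit the bi-freeness. With `γ = (z + 1) / z`, Haagerup's factorisation
`1 - γ t₀ t₁ a₀ a₁ = (1 + z) (1 - t₀ a₀) (1 - γ x₀ x₁) (1 - t₁ a₁)` at `t_k = 𝒳_{a_k}(z)` turns the
resolvent of `a₀ a₁` into a sum over the alternating words in `x₀` and `x₁`.

In the free product, right operators with mean zero create words from the state vector and left
ones annihilate them letter by letter, so distinct words are orthogonal and `H_{a₀a₁, b₀b₁}` is the
sum of a geometric series whose ratio is `c g₀ g₁`, where `g_k = φ(x_k(z) y_k(w))` and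
`c = ((z + 1) / z) ((w + 1) / w)`. The transform of `(a_k, b_k)` is `(1 + c g_k) / (1 + g_k)`, and
that of the product is the product of these two quotients.
-/

namespace BiFree

noncomputable section

section Operators

theorem alternating_cons {ι : Type*} {V : ι → Type*} {k : ι} {l : List (Σ k, V k)} (x : V k)
    (hk : NotHead k l) (hl : Alternating l) : Alternating (⟨k, x⟩ :: l) :=
  List.isChain_cons.2 ⟨fun z hz => (hk z hz).symm, hl⟩

theorem coe_prod_map_apply {R M κ : Type*} [Semiring R] [AddCommMonoid M] [Module R M]
    {p : Submodule R M} {F : κ → Module.End R p} {G : κ → Module.End R M}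
    (h : ∀ k v, (F k v : M) = G k v) (l : List κ) (v : p) :
    ((l.map F).prod v : M) = (l.map G).prod v := by
  induction l with
  | nil => rfl
  | cons k l ih => simp only [List.map_cons, List.prod_cons, Module.End.mul_apply, h, ih]

theorem isChain_ne_reverse {κ : Type*} {l : List κ} (hl : l.IsChain (· ≠ ·)) :
    l.reverse.IsChain (· ≠ ·) :=
  List.isChain_reverse.2 (hl.imp fun _ _ => Ne.symm)

variable {ι : Type u} [DecidableEq ι] {V : ι → Type v}
  [∀ k, AddCommGroup (V k)] [∀ k, Module ℂ (V k)]

theorem freeProd_hom_ext_left {N : Type*} [AddCommGroup N] [Module ℂ N]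
    {F G : freeProd V →ₗ[ℂ] N} (k : ι)
    (h : ∀ (v : freeProd V) y l, NotHead k l → (v : Tens V) = incl k y * word l → F v = G v) :
    F = G :=
  LinearMap.ext_on Submodule.span_span_coe_preimage fun v ⟨l, hl, hv⟩ =>
    let ⟨y, l', _, hl', hl_eq⟩ := exists_left k l hl
    h v y l' hl' (hv.trans hl_eq)

theorem freeProd_hom_ext_right {N : Type*} [AddCommGroup N] [Module ℂ N]
    {F G : freeProd V →ₗ[ℂ] N} (k : ι)
    (h : ∀ (v : freeProd V) y l, NotLast k l → (v : Tens V) = word l * incl k y → F v = G v) :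
    F = G :=
  LinearMap.ext_on Submodule.span_span_coe_preimage fun v ⟨l, hl, hv⟩ =>
    let ⟨y, l', _, hl', hl_eq⟩ := exists_right k l hl
    h v y l' hl' (hv.trans hl_eq)

/-- The left representation `λ_k` as a homomorphism of algebras. -/
def leftHom (k : ι) : Module.End ℂ (ℂ × V k) →ₐ[ℂ] Module.End ℂ (freeProd V) :=
  AlgHom.ofLinearMap
    { toFun := leftOp k
      map_add' := fun T T' => freeProd_hom_ext_left k fun v y l hl hv => Subtype.ext <| by
        simp [leftOp, hv, leftTens_incl_mul k _ _ l hl, add_mul]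
      map_smul' := fun c T => freeProd_hom_ext_left k fun v y l hl hv => Subtype.ext <| by
        simp [leftOp, hv, leftTens_incl_mul k _ _ l hl] }
    (freeProd_hom_ext_left k fun v y l hl hv => Subtype.ext <| by
      simp [leftOp, hv, leftTens_incl_mul k _ _ l hl])
    (fun T T' => freeProd_hom_ext_left k fun v y l hl hv => Subtype.ext <| by
      simp [leftOp, hv, leftTens_incl_mul k _ _ l hl])

/-- The right representation `ρ_k` as a homomorphism of algebras. -/
def rightHom (k : ι) : Module.End ℂ (ℂ × V k) →ₐ[ℂ] Module.End ℂ (freeProd V) :=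
  AlgHom.ofLinearMap
    { toFun := rightOp k
      map_add' := fun T T' => freeProd_hom_ext_right k fun v y l hl hv => Subtype.ext <| by
        simp [rightOp, hv, rightTens_mul_incl k _ _ l hl, mul_add]
      map_smul' := fun c T => freeProd_hom_ext_right k fun v y l hl hv => Subtype.ext <| by
        simp [rightOp, hv, rightTens_mul_incl k _ _ l hl] }
    (freeProd_hom_ext_right k fun v y l hl hv => Subtype.ext <| by
      simp [rightOp, hv, rightTens_mul_incl k _ _ l hl])
    (fun T T' => freeProd_hom_ext_right k fun v y l hl hv => Subtype.ext <| by
      simp [rightOp, hv, rightTens_mul_incl k _ _ l hl])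

/-- The state `T ↦ (coefficient of ξ in T ξ)` on the operators on a vector space `ℂ × E` with
state vector `ξ = (1, 0)`. -/
def vectorState {E : Type*} [AddCommGroup E] [Module ℂ E] (T : Module.End ℂ (ℂ × E)) : ℂ :=
  (T (1, 0)).1

theorem algebraMapInv_letter (k : ι) (x : V k) :
    TensorAlgebra.algebraMapInv (letter k x) = 0 := by
  simp [TensorAlgebra.algebraMapInv, letter]

theorem algebraMapInv_word (l : List (Σ k, V k)) :
    TensorAlgebra.algebraMapInv (word l) = if l = [] then 1 else 0 := by
  cases l with
  | nil => simp [word]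
  | cons x l => simp [word_cons, algebraMapInv_letter]

theorem algebraMapInv_incl (k : ι) (y : ℂ × V k) :
    TensorAlgebra.algebraMapInv (incl k y) = y.1 := by
  rw [incl_apply, map_add, algebraMapInv_letter, AlgHom.commutes, Algebra.algebraMap_self_apply,
    add_zero]

theorem vacuumState_leftHom_mul_rightHom (k : ι) (T S : Module.End ℂ (ℂ × V k)) :
    vacuumState V (leftHom k T * rightHom k S) = vectorState (T * S) := by
  have h := leftTens_incl_mul k T (S (1, 0)) [] (by simp [NotHead])
  rw [word, List.map_nil, List.prod_nil, mul_one, mul_one, ← rightTens_one k S] at h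
  exact (congrArg TensorAlgebra.algebraMapInv h).trans (algebraMapInv_incl k _)

theorem vacuumState_leftHom (k : ι) (T : Module.End ℂ (ℂ × V k)) :
    vacuumState V (leftHom k T) = vectorState T := by
  simpa using vacuumState_leftHom_mul_rightHom k T 1

theorem vacuumState_rightHom (k : ι) (T : Module.End ℂ (ℂ × V k)) :
    vacuumState V (rightHom k T) = vectorState T := by
  simpa using vacuumState_leftHom_mul_rightHom k 1 T

theorem incl_eq_letter {k : ι} {y : ℂ × V k} (hy : y.1 = 0) : incl k y = letter k y.2 := by
  rw [incl_apply, hy, map_zero, zero_add]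

theorem leftTens_word_of_notHead {k : ι} {T : Module.End ℂ (ℂ × V k)} (hT : vectorState T = 0)
    {l : List (Σ k, V k)} (hl : NotHead k l) :
    leftTens k T (word l) = word (⟨k, (T (1, 0)).2⟩ :: l) := by
  have h := leftTens_incl_mul k T (1, 0) l hl
  simpa [incl_eq_letter hT, incl_apply, word_cons] using h

theorem rightTens_word_of_notLast {k : ι} {T : Module.End ℂ (ℂ × V k)} (hT : vectorState T = 0)
    {l : List (Σ k, V k)} (hl : NotLast k l) :
    rightTens k T (word l) = word (l ++ [⟨k, (T (1, 0)).2⟩]) := by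
  have h := rightTens_mul_incl k T (1, 0) l hl
  simpa [incl_eq_letter hT, incl_apply, word_concat] using h

theorem leftTens_word_cons (k : ι) (T : Module.End ℂ (ℂ × V k)) (x : V k)
    (l : List (Σ k, V k)) :
    leftTens k T (word (⟨k, x⟩ :: l)) =
      (T (0, x)).1 • word l + word (⟨k, (T (0, x)).2⟩ :: l) := by
  rw [word_cons, leftTens_same, incl_apply, add_mul, ← Algebra.smul_def, word_cons]

theorem prod_rightTens_one {y : ∀ k, Module.End ℂ (ℂ × V k)} (hy : ∀ k, vectorState (y k) = 0)
    {m : List ι} (hm : m.IsChain (· ≠ ·)) :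
    (m.map fun k => rightTens k (y k)).prod 1 =
      word (m.reverse.map fun k => ⟨k, (y k (1, 0)).2⟩) := by
  induction m with
  | nil => rfl
  | cons i m ih =>
    obtain ⟨hi, hm⟩ := List.isChain_cons.1 hm
    rw [List.map_cons, List.prod_cons, Module.End.mul_apply, ih hm,
      rightTens_word_of_notLast (hy i), List.reverse_cons, List.map_append, List.map_singleton]
    intro z hz
    rw [List.getLast?_map, List.getLast?_reverse] at hz
    obtain ⟨j, hj, rfl⟩ := Option.mem_map.1 hz
    exact (hi j hj).symm

theorem algebraMapInv_prod_leftTens_word {x : ∀ k, Module.End ℂ (ℂ × V k)}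
    (hx : ∀ k, vectorState (x k) = 0) {l : List ι} (hl : l.IsChain (· ≠ ·))
    {w : List (Σ k, V k)} (hw : Alternating w) :
    TensorAlgebra.algebraMapInv ((l.reverse.map fun k => leftTens k (x k)).prod (word w)) =
      if w.map Sigma.fst = l then (w.map fun v => (x v.1 (0, v.2)).1).prod else 0 := by
  induction l generalizing w with
  | nil => cases w <;> simp [algebraMapInv_word]
  | cons j l ih =>
    obtain ⟨hj, hl⟩ := List.isChain_cons.1 hl
    have hne (r : V j) (w : List (Σ k, V k)) : (⟨j, r⟩ :: w).map Sigma.fst ≠ l := by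
      rintro rfl
      exact hj j rfl rfl
    rw [List.reverse_cons, List.map_append, List.prod_append, Module.End.mul_apply,
      List.map_singleton, List.prod_singleton]
    by_cases hw_head : NotHead j w
    · have hw_ne : w.map Sigma.fst ≠ j :: l := by
        intro h
        obtain ⟨v, w, rfl, rfl, rfl⟩ := List.map_eq_cons_iff.1 h
        exact hw_head v rfl rfl
      rw [leftTens_word_of_notHead (hx j) hw_head, ih hl (alternating_cons _ hw_head hw),
        if_neg (hne _ _), if_neg hw_ne]
    · obtain ⟨v, w, rfl⟩ : ∃ v w', w = ⟨j, v⟩ :: w' := by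
        cases w with
        | nil => simp [NotHead] at hw_head
        | cons v w =>
          obtain ⟨i, v⟩ := v
          obtain rfl : i = j := by simpa [NotHead] using hw_head
          exact ⟨v, w, rfl⟩
      obtain ⟨hv, hw⟩ := List.isChain_cons.1 hw
      have hw_head : NotHead j w := fun z hz => (hv z hz).symm
      rw [leftTens_word_cons, map_add, map_add, map_smul, map_smul, ih hl hw,
        ih hl (alternating_cons _ hw_head hw), if_neg (hne _ _), add_zero]
      simp

theorem vacuumState_prod_leftHom_mul_prod_rightHom {x y : ∀ k, Module.End ℂ (ℂ × V k)}
    (hx : ∀ k, vectorState (x k) = 0) (hy : ∀ k, vectorState (y k) = 0)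
    {l m : List ι} (hl : l.IsChain (· ≠ ·)) (hm : m.IsChain (· ≠ ·)) :
    vacuumState V ((l.map fun k => leftHom k (x k)).prod *
        (m.map fun k => rightHom k (y k)).prod) =
      if l = m then (l.map fun k => vectorState (x k * y k)).prod else 0 := by
  have hstate (k : ι) : (x k (0, (y k (1, 0)).2)).1 = vectorState (x k * y k) := by
    have hyk : y k (1, 0) = (0, (y k (1, 0)).2) := Prod.ext (hy k) rfl
    rw [vectorState, Module.End.mul_apply, ← hyk]
  have hcoe : vacuumState V ((l.map fun k => leftHom k (x k)).prod *
      (m.map fun k => rightHom k (y k)).prod) = TensorAlgebra.algebraMapInv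
        ((l.map fun k => leftTens k (x k)).prod
          ((m.map fun k => rightTens k (y k)).prod 1)) := by
    rw [vacuumState, vacuumCoeff, LinearMap.comp_apply, LinearMap.comp_apply,
      LinearMap.applyₗ_apply_apply, Module.End.mul_apply, Submodule.subtype_apply,
      AlgHom.toLinearMap_apply, coe_prod_map_apply (G := fun k => leftTens k (x k)) fun _ _ => rfl,
      coe_prod_map_apply (G := fun k => rightTens k (y k)) fun _ _ => rfl]
    rfl
  have hword : Alternating (m.reverse.map fun k => (⟨k, (y k (1, 0)).2⟩ : Σ k, V k)) :=
    (List.isChain_map _).2 (isChain_ne_reverse hm)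
  have h := algebraMapInv_prod_leftTens_word hx (isChain_ne_reverse hl) hword
  rw [List.reverse_reverse] at h
  rw [hcoe, prod_rightTens_one hy hm, h]
  obtain rfl | hlm := eq_or_ne l m
  · simp [Function.comp_def, hstate, List.prod_reverse]
  · simp [Function.comp_def, hlm, hlm.symm]

end Operators

section Moments

/-- The moments of alternating words in centred bi-free pairs `(x k, y k)`: right variables create
a word from the state vector and left variables annihilate it again letter by letter, so that the
only nonzero moments are those with the same indices on both sides. -/
def CentredBiFree {ι A : Type*} [DecidableEq ι] [Monoid A] (φ : A → ℂ) (x y : ι → A) : Prop :=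
  ∀ ⦃l m : List ι⦄, l.IsChain (· ≠ ·) → m.IsChain (· ≠ ·) →
    φ ((l.map x).prod * (m.map y).prod) =
      if l = m then (l.map fun k => φ (x k * y k)).prod else 0

theorem jointDistribution_prod_aeval_mul_prod_aeval {ι A : Type*} [Ring A] [Algebra ℂ A]
    (φ : A →ₗ[ℂ] ℂ) (a b : ι → A) (P Q : ι → Polynomial ℂ) (l m : List ι) :
    jointDistribution φ (Sum.elim a b)
        ((l.map fun k => (P k).aeval (FreeAlgebra.ι ℂ (Sum.inl k))).prod *
          (m.map fun k => (Q k).aeval (FreeAlgebra.ι ℂ (Sum.inr k))).prod) =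
      φ ((l.map fun k => (P k).aeval (a k)).prod * (m.map fun k => (Q k).aeval (b k)).prod) := by
  simp [jointDistribution, map_list_prod, Function.comp_def, ← Polynomial.aeval_algHom_apply]

variable {ι : Type u} [DecidableEq ι] {A : Type w} [Ring A] [Algebra ℂ A]
  {φ : A →ₗ[ℂ] ℂ} {a b : ι → A}

theorem IsBiFree.map_one (h : IsBiFree.{u, v, w} φ a b) : φ 1 = 1 := by
  obtain ⟨V, _, _, T, S, hd⟩ := h
  have h1 := LinearMap.congr_fun hd 1
  simp only [jointDistribution, LinearMap.comp_apply, AlgHom.toLinearMap_apply, _root_.map_one]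
    at h1
  rw [h1]
  exact _root_.map_one TensorAlgebra.algebraMapInv

theorem IsBiFree.centredBiFree_of_mem_adjoin (h : IsBiFree.{u, v, w} φ a b) {x y : ι → A}
    (hx : ∀ k, x k ∈ Algebra.adjoin ℂ {a k}) (hy : ∀ k, y k ∈ Algebra.adjoin ℂ {b k})
    (hφx : ∀ k, φ (x k) = 0) (hφy : ∀ k, φ (y k) = 0) : CentredBiFree φ x y := by
  obtain ⟨V, _, _, T, S, hd⟩ := h
  simp only [Algebra.adjoin_singleton_eq_range_aeval, AlgHom.mem_range] at hx hy
  choose P hP using hx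
  choose Q hQ using hy
  obtain rfl : (fun k => (P k).aeval (a k)) = x := funext hP
  obtain rfl : (fun k => (Q k).aeval (b k)) = y := funext hQ
  have transfer (l m : List ι) :
      φ ((l.map fun k => (P k).aeval (a k)).prod * (m.map fun k => (Q k).aeval (b k)).prod) =
        vacuumState V ((l.map fun k => leftHom k ((P k).aeval (T k))).prod *
          (m.map fun k => rightHom k ((Q k).aeval (S k))).prod) := by
    simp only [← Polynomial.aeval_algHom_apply]
    rw [← jointDistribution_prod_aeval_mul_prod_aeval, hd]
    exact jointDistribution_prod_aeval_mul_prod_aeval _ _ _ P Q l m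
  have hleft (k : ι) : vectorState ((P k).aeval (T k)) = 0 := by
    rw [← vacuumState_leftHom, ← hφx k]
    simpa using (transfer [k] []).symm
  have hright (k : ι) : vectorState ((Q k).aeval (S k)) = 0 := by
    rw [← vacuumState_rightHom, ← hφy k]
    simpa using (transfer [] [k]).symm
  have hmoment (k : ι) : φ ((P k).aeval (a k) * (Q k).aeval (b k)) =
      vectorState ((P k).aeval (T k) * (Q k).aeval (S k)) := by
    rw [← vacuumState_leftHom_mul_rightHom]
    simpa using transfer [k] [k]
  intro l m hl hm
  rw [transfer, vacuumState_prod_leftHom_mul_prod_rightHom hleft hright hl hm]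
  simp only [hmoment]

theorem map_mul_of_map_centred_mul_eq_zero (hφ : φ 1 = 1) {s t : A}
    (h : φ ((s - algebraMap ℂ A (φ s)) * (t - algebraMap ℂ A (φ t))) = 0) :
    φ (s * t) = φ s * φ t := by
  simp only [Algebra.algebraMap_eq_smul_one, sub_mul, mul_sub, map_sub, smul_mul_assoc,
    mul_smul_comm, one_mul, mul_one, map_smul, hφ, smul_eq_mul] at h
  linear_combination h

theorem sub_algebraMap_mem_adjoin (s : A) (c : ℂ) :
    s - algebraMap ℂ A c ∈ Algebra.adjoin ℂ {s} :=
  sub_mem (Algebra.self_mem_adjoin_singleton ℂ s) (algebraMap_mem _ c)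

theorem map_sub_algebraMap (hφ : φ 1 = 1) (s : A) : φ (s - algebraMap ℂ A (φ s)) = 0 := by
  simp [Algebra.algebraMap_eq_smul_one, hφ]

theorem IsBiFree.map_mul_left (h : IsBiFree.{u, v, w} φ a b) {i j : ι} (hij : i ≠ j) :
    φ (a i * a j) = φ (a i) * φ (a j) := by
  have hfree := h.centredBiFree_of_mem_adjoin (x := fun k => a k - algebraMap ℂ A (φ (a k)))
    (y := 0) (fun _ => sub_algebraMap_mem_adjoin _ _) (fun _ => zero_mem _)
    (fun _ => map_sub_algebraMap h.map_one _) (fun _ => map_zero φ)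
  refine map_mul_of_map_centred_mul_eq_zero h.map_one ?_
  simpa using hfree (l := [i, j]) (m := []) (by simpa) List.isChain_nil

theorem IsBiFree.map_mul_right (h : IsBiFree.{u, v, w} φ a b) {i j : ι} (hij : i ≠ j) :
    φ (b i * b j) = φ (b i) * φ (b j) := by
  have hfree := h.centredBiFree_of_mem_adjoin (x := 0)
    (y := fun k => b k - algebraMap ℂ A (φ (b k))) (fun _ => zero_mem _)
    (fun _ => sub_algebraMap_mem_adjoin _ _) (fun _ => map_zero φ)
    (fun _ => map_sub_algebraMap h.map_one _)
  refine map_mul_of_map_centred_mul_eq_zero h.map_one ?_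
  simpa using hfree (l := []) (m := [i, j]) List.isChain_nil (by simpa)

end Moments

section Closure

variable {A : Type w} [NormedRing A] [NormedAlgebra ℂ A] {φ : A →L[ℂ] ℂ}

theorem mem_closure_centred (hφ : φ 1 = 1) {S : Subalgebra ℂ A} {x : A}
    (hx : x ∈ closure (S : Set A)) (hφx : φ x = 0) :
    x ∈ closure {s | s ∈ S ∧ φ s = 0} := by
  have hcont : Continuous fun s : A => s - algebraMap ℂ A (φ s) := by fun_prop
  have h := map_mem_closure (t := {s | s ∈ S ∧ φ s = 0}) hcont hx fun s hs =>
    ⟨sub_mem hs (algebraMap_mem S _), map_sub_algebraMap (φ := φ.toLinearMap) hφ s⟩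
  rwa [hφx, map_zero, sub_zero] at h

variable {ι : Type u} [DecidableEq ι] {a b : ι → A}

theorem isClosed_setOf_centredBiFree :
    IsClosed {p : (ι → A) × (ι → A) | CentredBiFree φ p.1 p.2} := by
  simp only [CentredBiFree, Set.ofPred_forall]
  refine isClosed_iInter fun l => isClosed_iInter fun m => isClosed_iInter fun _ =>
    isClosed_iInter fun _ => isClosed_eq ?_ ?_
  · exact φ.continuous.comp ((continuous_list_prod _ fun k _ => by fun_prop).mul
      (continuous_list_prod _ fun k _ => by fun_prop))
  · split_ifs
    · exact continuous_list_prod _ fun k _ => by fun_prop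
    · exact continuous_const

theorem IsBiFree.centredBiFree (h : IsBiFree.{u, v, w} (φ : A →ₗ[ℂ] ℂ) a b) {x y : ι → A}
    (hx : ∀ k, x k ∈ Algebra.elemental ℂ (a k)) (hy : ∀ k, y k ∈ Algebra.elemental ℂ (b k))
    (hφx : ∀ k, φ (x k) = 0) (hφy : ∀ k, φ (y k) = 0) : CentredBiFree φ x y := by
  have hmem : (x, y) ∈ closure
      ((Set.univ.pi fun k => {s | s ∈ Algebra.adjoin ℂ {a k} ∧ φ s = 0}) ×ˢ
        (Set.univ.pi fun k => {s | s ∈ Algebra.adjoin ℂ {b k} ∧ φ s = 0})) := by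
    rw [closure_prod_eq, closure_pi_set, closure_pi_set]
    exact ⟨fun k _ => mem_closure_centred h.map_one (hx k) (hφx k),
      fun k _ => mem_closure_centred h.map_one (hy k) (hφy k)⟩
  refine closure_minimal (fun p hp => ?_) isClosed_setOf_centredBiFree hmem
  exact h.centredBiFree_of_mem_adjoin (fun k => (hp.1 k trivial).1) (fun k => (hp.2 k trivial).1)
    (fun k => (hp.1 k trivial).2) (fun k => (hp.2 k trivial).2)

end Closure

section AlternatingWords

/-- The indices `i, i + 1, i, …` of an alternating word of length `n` in two letters. -/
def altList : Fin 2 → ℕ → List (Fin 2)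
  | _, 0 => []
  | i, n + 1 => i :: altList (i + 1) n

theorem isChain_altList (i : Fin 2) (n : ℕ) : (altList i n).IsChain (· ≠ ·) := by
  induction n generalizing i with
  | zero => exact List.isChain_nil
  | succ n ih =>
    refine List.isChain_cons.2 ⟨?_, ih _⟩
    cases n <;> simp [altList]

theorem altList_eq_iff {i j : Fin 2} {n m : ℕ} :
    altList i n = altList j m ↔ n = m ∧ (n = 0 ∨ i = j) := by
  induction n generalizing i j m with
  | zero => cases m <;> simp [altList]
  | succ n ih =>
    cases m with
    | zero => simp [altList]
    | succ m =>
      simp only [altList, List.cons.injEq, ih, add_left_inj]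
      tauto

section Monoid

variable {M : Type*} [Monoid M] (x : Fin 2 → M)

theorem prod_map_altList_one_succ (n : ℕ) :
    ((altList 1 (n + 1)).map x).prod = x 1 * ((altList 0 n).map x).prod := by
  simp [altList]

theorem prod_map_altList_zero_add_two (n : ℕ) :
    ((altList 0 (n + 2)).map x).prod = x 0 * x 1 * ((altList 0 n).map x).prod := by
  simp [altList, mul_assoc]

theorem prod_map_altList_zero_even (n : ℕ) :
    ((altList 0 (2 * n)).map x).prod = (x 0 * x 1) ^ n := by
  induction n with
  | zero => simp [altList]
  | succ n ih => rw [mul_add_one, prod_map_altList_zero_add_two, ih, pow_succ']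

theorem prod_map_altList_zero_odd (n : ℕ) :
    ((altList 0 (2 * n + 1)).map x).prod = (x 0 * x 1) ^ n * x 0 := by
  induction n with
  | zero => simp [altList]
  | succ n ih =>
    rw [mul_add_one, add_right_comm, prod_map_altList_zero_add_two, ih, pow_succ', mul_assoc,
      mul_assoc, mul_assoc]

end Monoid

/-- The sum of the four alternating words in `x 0`, `x 1` that contain the product `x 0 * x 1`
exactly `n` times. -/
def altSum {A : Type*} [Semiring A] (x : Fin 2 → A) (n : ℕ) : A :=
  (1 + x 1) * (x 0 * x 1) ^ n * (1 + x 0)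

theorem altSum_eq_sum_words {A : Type*} [Semiring A] (x : Fin 2 → A) (n : ℕ) :
    altSum x n = ((altList 0 (2 * n)).map x).prod + ((altList 0 (2 * n + 1)).map x).prod +
      ((altList 1 (2 * n + 1)).map x).prod + ((altList 1 (2 * n + 2)).map x).prod := by
  rw [prod_map_altList_one_succ, prod_map_altList_one_succ, prod_map_altList_zero_even,
    prod_map_altList_zero_odd, altSum, add_mul, one_mul, mul_add, mul_one, add_mul, mul_assoc]
  abel

theorem CentredBiFree.map_altSum_mul_altSum {F A : Type*} [Semiring A] [FunLike F A ℂ]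
    [AddMonoidHomClass F A ℂ] {φ : F} {x y : Fin 2 → A} (h : CentredBiFree φ x y) (n m : ℕ) :
    φ (altSum x n * altSum y m) =
      if n = m then (φ (x 0 * y 0) * φ (x 1 * y 1)) ^ n *
        ((1 + φ (x 0 * y 0)) * (1 + φ (x 1 * y 1))) else 0 := by
  have hword (i n j m) : φ (((altList i n).map x).prod * ((altList j m).map y).prod) =
      if n = m ∧ (n = 0 ∨ i = j) then ((altList i n).map fun k => φ (x k * y k)).prod else 0 := by
    rw [h (isChain_altList i n) (isChain_altList j m)]
    simp only [altList_eq_iff]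
  simp only [altSum_eq_sum_words, mul_add, add_mul, map_add, hword]
  obtain rfl | hnm := eq_or_ne n m
  · rw [if_pos rfl]
    set g := fun k => φ (x k * y k)
    calc
      _ = (g 0 * g 1) ^ n + (g 0 * g 1) ^ n * g 0 + g 1 * (g 0 * g 1) ^ n +
          g 1 * ((g 0 * g 1) ^ n * g 0) := by
        simp [prod_map_altList_one_succ, prod_map_altList_zero_even, prod_map_altList_zero_odd]
      _ = _ := by ring
  · have hparity₁ (k l : ℕ) : 2 * k ≠ 2 * l + 1 := by lia
    have hparity₂ (k l : ℕ) : 2 * k + 1 ≠ 2 * l := by lia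
    have hpos (k l : ℕ) : 2 * k = 2 * l + 2 → k ≠ 0 := by lia
    simp +contextual [hnm, hparity₁, hparity₂, hpos]

end AlternatingWords

section Resolvents

/-- The resolvent `∑ cⁿ altSum x n` of the alternating words in `x`, in closed form. -/
def altResolvent {K A : Type*} [Field K] [Ring A] [Algebra K A] (x : Fin 2 → A) (c : K) : A :=
  (1 + x 1) * Ring.inverse (1 - c • (x 0 * x 1)) * (1 + x 0)

theorem altResolvent_zero {K A : Type*} [Field K] [Ring A] [Algebra K A] (c : K) :
    altResolvent (0 : Fin 2 → A) c = 1 := by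
  simp [altResolvent]

theorem inverse_one_sub_smul_mul {K A : Type*} [Field K] [Ring A] [Algebra K A]
    {a x : Fin 2 → A} {τ : Fin 2 → K} {z : K} (hz : z ≠ 0) (hz1 : 1 + z ≠ 0)
    (hτ : ∀ k, IsUnit (1 - τ k • a k))
    (hx : ∀ k, Ring.inverse (1 - τ k • a k) = (1 + z) • (1 + x k))
    (hr : IsUnit (1 - ((z + 1) / z) • (x 0 * x 1))) :
    Ring.inverse (1 - ((z + 1) / z * (τ 0 * τ 1)) • (a 0 * a 1)) =
      (1 + z) • altResolvent x ((z + 1) / z) := by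
  set u : Fin 2 → A := fun k => 1 - τ k • a k
  have hu₀ : ((1 + z) • u 0) * (1 + x 0) = 1 := by
    rw [smul_mul_assoc, ← mul_smul_comm, ← hx, Ring.mul_inverse_cancel _ (hτ 0)]
  have hu₁ : (1 + x 1) * ((1 + z) • u 1) = 1 := by
    rw [mul_smul_comm, ← smul_mul_assoc, ← hx, Ring.inverse_mul_cancel _ (hτ 1)]
  have hux₀ : ((1 + z) • u 0) * x 0 = 1 - (1 + z) • u 0 := by
    rw [← hu₀, mul_add, mul_one, add_sub_cancel_left]
  have hxu₁ : x 1 * ((1 + z) • u 1) = 1 - (1 + z) • u 1 := by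
    rw [← hu₁, add_mul, one_mul, add_sub_cancel_left]
  have hinv₀ : Ring.inverse ((1 + z) • u 0) = 1 + x 0 := by
    have hunit : IsUnit ((1 + z) • u 0) := by
      rw [Algebra.smul_def]
      exact ((IsUnit.mk0 _ hz1).map (algebraMap K A)).mul (hτ 0)
    rw [← mul_one (Ring.inverse _), Ring.inverse_mul_eq_iff_eq_mul _ _ _ hunit, hu₀]
  have hfactor : 1 - ((z + 1) / z * (τ 0 * τ 1)) • (a 0 * a 1) =
      ((1 + z) • u 0) * (1 - ((z + 1) / z) • (x 0 * x 1)) * u 1 := by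
    symm
    calc
      _ = (1 + z) • (u 0 * u 1) - z⁻¹ • (((1 + z) • u 0 * x 0) * (x 1 * ((1 + z) • u 1))) := by
        simp only [mul_sub, sub_mul, mul_one, mul_assoc, smul_mul_assoc, mul_smul_comm]
        match_scalars <;> field_simp
        ring
      _ = (1 + z) • (u 0 * u 1) - z⁻¹ • ((1 - (1 + z) • u 0) * (1 - (1 + z) • u 1)) := by
        rw [hux₀, hxu₁]
      _ = _ := by
        simp only [u, mul_sub, sub_mul, mul_one, one_mul, smul_sub, smul_mul_assoc, mul_smul_comm]
        match_scalars <;> field_simp <;> ring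
  rw [hfactor, Ring.inverse_mul (.inr (hτ 1)), Ring.inverse_mul (.inr hr), hinv₀, hx, altResolvent,
    smul_mul_assoc, mul_assoc]

theorem hasSum_altResolvent {𝕜 A : Type*} [NormedField 𝕜] [NormedRing A] [NormedAlgebra 𝕜 A]
    [CompleteSpace A] {x : Fin 2 → A} {c : 𝕜} (hc : ‖c • (x 0 * x 1)‖ < 1) :
    HasSum (fun n => c ^ n • altSum x n) (altResolvent x c) := by
  simpa only [altSum, altResolvent, smul_pow, mul_smul_comm, smul_mul_assoc] using
    ((hasSum_geom_series_inverse _ hc).mul_left (1 + x 1)).mul_right (1 + x 0)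

variable {A : Type*} [NormedRing A] [NormedAlgebra ℂ A] [CompleteSpace A]

theorem CentredBiFree.map_altResolvent_mul_altResolvent {φ : A →L[ℂ] ℂ} {x y : Fin 2 → A}
    (h : CentredBiFree φ x y) {c d : ℂ} (hc : ‖c • (x 0 * x 1)‖ < 1)
    (hd : ‖d • (y 0 * y 1)‖ < 1) :
    φ (altResolvent x c * altResolvent y d) =
      (1 + φ (x 0 * y 0)) * (1 + φ (x 1 * y 1)) /
        (1 - c * d * (φ (x 0 * y 0) * φ (x 1 * y 1))) := by
  set g := φ (x 0 * y 0) * φ (x 1 * y 1)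
  set κ := (1 + φ (x 0 * y 0)) * (1 + φ (x 1 * y 1))
  have hright (n : ℕ) : φ (altSum x n * altResolvent y d) = d ^ n * (g ^ n * κ) := by
    have hsum := ((hasSum_altResolvent hd).mul_left (altSum x n)).mapL φ
    simp only [mul_smul_comm, map_smul, h.map_altSum_mul_altSum, smul_eq_mul, mul_ite, mul_zero]
      at hsum
    refine hsum.unique ?_
    convert hasSum_ite_eq n (d ^ n * (g ^ n * κ)) using 2 with m
    obtain rfl | hmn := eq_or_ne m n
    · rw [if_pos rfl]
    · rw [if_neg hmn, if_neg hmn.symm]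
  have hgeom : HasSum (fun n => (c * d * g) ^ n * κ) (φ (altResolvent x c * altResolvent y d)) := by
    have hsum := ((hasSum_altResolvent hc).mul_right (altResolvent y d)).mapL φ
    simp only [smul_mul_assoc, map_smul, hright, smul_eq_mul] at hsum
    refine hsum.congr_fun fun n => ?_
    ring
  obtain hκ | hκ := eq_or_ne κ 0
  · simp only [hκ, mul_zero, zero_div] at hgeom ⊢
    exact hgeom.unique hasSum_zero
  · have hnorm : ‖c * d * g‖ < 1 :=
      summable_geometric_iff_norm_lt_one.1 ((summable_mul_right_iff hκ).1 hgeom.summable)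
    rw [div_eq_inv_mul]
    exact hgeom.unique ((hasSum_geometric_of_norm_lt_one hnorm).mul_right κ)

theorem CentredBiFree.map_altResolvent_left {φ : A →L[ℂ] ℂ} {x : Fin 2 → A}
    (h : CentredBiFree φ x 0) {c : ℂ} (hc : ‖c • (x 0 * x 1)‖ < 1) :
    φ (altResolvent x c) = 1 := by
  simpa [altResolvent_zero] using h.map_altResolvent_mul_altResolvent hc (d := c) (by simp)

theorem CentredBiFree.map_altResolvent_right {φ : A →L[ℂ] ℂ} {y : Fin 2 → A}
    (h : CentredBiFree φ 0 y) {c : ℂ} (hc : ‖c • (y 0 * y 1)‖ < 1) :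
    φ (altResolvent y c) = 1 := by
  simpa [altResolvent_zero] using h.map_altResolvent_mul_altResolvent (c := c) (by simp) hc

end Resolvents

section LocalInverse

theorem tendsto_add_one_div_smul_mul {𝕜 E : Type*} [NontriviallyNormedField 𝕜] [NormedRing E]
    [NormedAlgebra 𝕜 E] {f g : 𝕜 → E} (hf : DifferentiableAt 𝕜 f 0) (hf₀ : f 0 = 0)
    (hg : ContinuousAt g 0) (hg₀ : g 0 = 0) :
    Tendsto (fun z => ((z + 1) / z) • (f z * g z)) (𝓝[≠] 0) (𝓝 0) := by
  have hfactor : Tendsto (fun z : 𝕜 => z + 1) (𝓝[≠] 0) (𝓝 (0 + 1)) :=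
    (continuousAt_id.add continuousAt_const).mono_left nhdsWithin_le_nhds
  have hslope := hasDerivAt_iff_tendsto_slope_zero.1 hf.hasDerivAt
  have hlim := (hfactor.smul hslope).mul (hg.mono_left nhdsWithin_le_nhds)
  rw [hg₀, mul_zero] at hlim
  refine hlim.congr fun z => ?_
  rw [zero_add, hf₀, sub_zero, smul_smul, smul_mul_assoc, div_eq_mul_inv]

theorem psi_zero {A : Type*} [NormedRing A] [NormedAlgebra ℂ A] {φ : A →L[ℂ] ℂ} (hφ : φ 1 = 1)
    (a : A) : psi φ a 0 = 0 := by
  simp [psi, hFun, hφ]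

variable {A : Type*} [NormedRing A] [NormedAlgebra ℂ A] [CompleteSpace A] {φ : A →L[ℂ] ℂ}

section Single

variable {a : A}

theorem chi_zero (hφ : φ 1 = 1) (ha : φ a ≠ 0) : chi φ a 0 = 0 := by
  rw [chi, dif_pos ha]
  simpa only [psi_zero hφ] using
    ((hasStrictDerivAt_psi φ a).eventually_left_inverse ha).self_of_nhds

theorem eventually_psi_chi (hφ : φ 1 = 1) (ha : φ a ≠ 0) :
    ∀ᶠ z in 𝓝 0, psi φ a (chi φ a z) = z := by
  rw [chi, dif_pos ha]
  simpa only [psi_zero hφ] using (hasStrictDerivAt_psi φ a).eventually_right_inverse ha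

theorem eventually_chi_psi (ha : φ a ≠ 0) : ∀ᶠ t in 𝓝 0, chi φ a (psi φ a t) = t := by
  rw [chi, dif_pos ha]
  exact (hasStrictDerivAt_psi φ a).eventually_left_inverse ha

theorem hasDerivAt_chi (hφ : φ 1 = 1) (ha : φ a ≠ 0) : HasDerivAt (chi φ a) (φ a)⁻¹ 0 := by
  rw [chi, dif_pos ha]
  simpa only [psi_zero hφ] using ((hasStrictDerivAt_psi φ a).to_localInverse ha).hasDerivAt

/-- The resolvent `(1 - 𝒳_a(z) a)⁻¹`, whose mean is `1 + z` near `z = 0`, normalised to mean `1` and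
then centred. -/
def centred (φ : A →L[ℂ] ℂ) (a : A) (z : ℂ) : A :=
  (1 + z)⁻¹ • Ring.inverse (1 - chi φ a z • a) - 1

theorem centred_zero (hφ : φ 1 = 1) (ha : φ a ≠ 0) : centred φ a 0 = 0 := by
  simp [centred, chi_zero hφ ha]

theorem differentiableAt_centred (hφ : φ 1 = 1) (ha : φ a ≠ 0) :
    DifferentiableAt ℂ (centred φ a) 0 := by
  have hpencil : DifferentiableAt ℂ (fun z => 1 - chi φ a z • a) 0 :=
    ((hasDerivAt_chi hφ ha).differentiableAt.smul_const a).const_sub 1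
  have hinverse : DifferentiableAt ℂ Ring.inverse (1 - chi φ a 0 • a) := by
    simpa [chi_zero hφ ha] using
      (hasStrictFDerivAt_ringInverse (𝕜 := ℂ) (1 : Aˣ)).hasFDerivAt.differentiableAt
  have hscalar : DifferentiableAt ℂ (fun z : ℂ => (1 + z)⁻¹) 0 :=
    (differentiableAt_id.const_add 1).inv (by simp)
  exact (hscalar.smul (hinverse.comp 0 hpencil)).sub_const 1

/-- The point `z` is close enough to `0` for `𝒳_a(z)` to be a preimage of `z` under `ψ_a` and for
the resolvent of `a` at `𝒳_a(z)` to be given by its Neumann series. -/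
structure IsRegularPoint (φ : A →L[ℂ] ℂ) (a : A) (z : ℂ) : Prop where
  one_add_ne_zero : 1 + z ≠ 0
  norm_chi_smul_lt_one : ‖chi φ a z • a‖ < 1
  psi_chi : psi φ a (chi φ a z) = z

theorem eventually_isRegularPoint (hφ : φ 1 = 1) (ha : φ a ≠ 0) :
    ∀ᶠ z in 𝓝 0, IsRegularPoint φ a z := by
  have hone : ∀ᶠ z : ℂ in 𝓝 0, 1 + z ≠ 0 :=
    (continuousAt_const.add continuousAt_id).eventually_ne (by simp)
  have hnorm : ∀ᶠ z in 𝓝 0, ‖chi φ a z • a‖ < 1 := by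
    refine ((hasDerivAt_chi hφ ha).continuousAt.smul continuousAt_const).norm.eventually_lt_const ?_
    simp [chi_zero hφ ha]
  filter_upwards [hone, hnorm, eventually_psi_chi hφ ha] with z h₁ h₂ h₃
  exact ⟨h₁, h₂, h₃⟩

namespace IsRegularPoint

variable {z : ℂ}

theorem isUnit (h : IsRegularPoint φ a z) : IsUnit (1 - chi φ a z • a) :=
  (Units.oneSub _ h.norm_chi_smul_lt_one).isUnit

theorem inverse_eq (h : IsRegularPoint φ a z) :
    Ring.inverse (1 - chi φ a z • a) = (1 + z) • (1 + centred φ a z) := by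
  rw [centred, add_sub_cancel, smul_inv_smul₀ h.one_add_ne_zero]

theorem map_centred (hφ : φ 1 = 1) (h : IsRegularPoint φ a z) : φ (centred φ a z) = 0 := by
  have hmean : φ (Ring.inverse (1 - chi φ a z • a)) = 1 + z := by
    rw [add_comm, ← sub_eq_iff_eq_add]
    exact h.psi_chi
  rw [centred, map_sub, map_smul, hmean, hφ, smul_eq_mul, inv_mul_cancel₀ h.one_add_ne_zero,
    sub_self]

theorem centred_mem_elemental (h : IsRegularPoint φ a z) :
    centred φ a z ∈ Algebra.elemental ℂ a := by
  have hinverse : Ring.inverse (1 - chi φ a z • a) ∈ Algebra.elemental ℂ a := by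
    refine (Algebra.elemental.isClosed ℂ a).mem_of_tendsto
      (hasSum_geom_series_inverse _ h.norm_chi_smul_lt_one).tendsto_sum_nat (.of_forall fun n => ?_)
    exact sum_mem fun i _ => pow_mem (Subalgebra.smul_mem _ (Algebra.elemental.self_mem ℂ a) _) i
  exact sub_mem (Subalgebra.smul_mem _ hinverse _) (one_mem _)

end IsRegularPoint

end Single

theorem HFun_chi_chi {a b : A} {z w : ℂ} (hφ : φ 1 = 1) (ha : IsRegularPoint φ a z)
    (hb : IsRegularPoint φ b w) :
    HFun φ a b (chi φ a z) (chi φ b w) =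
      (1 + z) * (1 + w) * (1 + φ (centred φ a z * centred φ b w)) := by
  simp only [HFun, ha.inverse_eq, hb.inverse_eq, smul_mul_smul_comm, map_smul, smul_eq_mul, mul_add,
    add_mul, mul_one, one_mul, map_add, hφ, ha.map_centred hφ, hb.map_centred hφ]
  ring

/-- The point `z` is regular for `a 0` and `a 1`, and so close to `0` that the alternating resolvent
in the centred resolvents of `a 0` and `a 1` is given by its series. -/
structure IsRegularPair (φ : A →L[ℂ] ℂ) (a : Fin 2 → A) (z : ℂ) : Prop where
  ne_zero : z ≠ 0
  isRegularPoint (k : Fin 2) : IsRegularPoint φ (a k) z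
  norm_smul_lt_one : ‖((z + 1) / z) • (centred φ (a 0) z * centred φ (a 1) z)‖ < 1

theorem eventually_isRegularPair {a : Fin 2 → A} (hφ : φ 1 = 1) (ha : ∀ k, φ (a k) ≠ 0) :
    ∀ᶠ z in 𝓝[≠] 0, IsRegularPair φ a z := by
  have hregular : ∀ᶠ z in 𝓝[≠] 0, ∀ k, IsRegularPoint φ (a k) z :=
    eventually_all.2 fun k => nhdsWithin_le_nhds (eventually_isRegularPoint hφ (ha k))
  have hnorm := (tendsto_add_one_div_smul_mul (differentiableAt_centred hφ (ha 0))
    (centred_zero hφ (ha 0)) (differentiableAt_centred hφ (ha 1)).continuousAt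
    (centred_zero hφ (ha 1))).norm
  rw [norm_zero] at hnorm
  filter_upwards [eventually_mem_nhdsWithin, hregular, hnorm.eventually_lt_const one_pos]
    with z h₁ h₂ h₃
  exact ⟨h₁, h₂, h₃⟩

theorem IsRegularPair.inverse_eq {a : Fin 2 → A} {z : ℂ} (h : IsRegularPair φ a z) :
    Ring.inverse (1 - ((z + 1) / z * (chi φ (a 0) z * chi φ (a 1) z)) • (a 0 * a 1)) =
      (1 + z) • altResolvent (fun k => centred φ (a k) z) ((z + 1) / z) :=
  inverse_one_sub_smul_mul (τ := fun k => chi φ (a k) z) h.ne_zero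
    (h.isRegularPoint 0).one_add_ne_zero (fun k => (h.isRegularPoint k).isUnit)
    (fun k => (h.isRegularPoint k).inverse_eq) (Units.oneSub _ h.norm_smul_lt_one).isUnit

theorem eventually_chi_mul {a : Fin 2 → A} (hφ : φ 1 = 1) (ha : ∀ k, φ (a k) ≠ 0)
    (hmul : φ (a 0 * a 1) ≠ 0)
    (hmean : ∀ z, IsRegularPair φ a z →
      φ (altResolvent (fun k => centred φ (a k) z) ((z + 1) / z)) = 1) :
    ∀ᶠ z in 𝓝[≠] 0,
      chi φ (a 0 * a 1) z = (z + 1) / z * (chi φ (a 0) z * chi φ (a 1) z) := by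
  have hlim := tendsto_add_one_div_smul_mul (hasDerivAt_chi hφ (ha 0)).differentiableAt
    (chi_zero hφ (ha 0)) (hasDerivAt_chi hφ (ha 1)).continuousAt (chi_zero hφ (ha 1))
  simp only [smul_eq_mul] at hlim
  filter_upwards [eventually_isRegularPair hφ ha, hlim.eventually (eventually_chi_psi hmul)]
    with z hz hchi
  rwa [psi, hFun, hz.inverse_eq, map_smul, hmean z hz, smul_eq_mul, mul_one, add_sub_cancel_left]
    at hchi

end LocalInverse

section STransform

variable {A : Type w} [NormedRing A] [NormedAlgebra ℂ A] [CompleteSpace A] {φ : A →L[ℂ] ℂ}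

theorem partialS_eq_of_HFun_eq {a b : A} {z w κ : ℂ} (hz : z ≠ 0) (hw : w ≠ 0) (hz1 : 1 + z ≠ 0)
    (hw1 : 1 + w ≠ 0)
    (h : HFun φ a b (chi φ a z) (chi φ b w) = (1 + z) * (1 + w) * κ) :
    partialS φ a b z w =
      (z + 1) / z * ((w + 1) / w) - ((z + 1) / z * ((w + 1) / w) - 1) / κ := by
  rw [partialS, h, ← div_div, div_eq_mul_inv _ κ, div_eq_mul_inv _ κ]
  field_simp
  ring

theorem eventually_one_add_map_centred_mul_ne_zero {a b : A} (hφ : φ 1 = 1) (ha : φ a ≠ 0)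
    (hb : φ b ≠ 0) :
    ∀ᶠ p : ℂ × ℂ in 𝓝[≠] 0 ×ˢ 𝓝[≠] 0, 1 + φ (centred φ a p.1 * centred φ b p.2) ≠ 0 := by
  have hle : 𝓝[≠] (0 : ℂ) ×ˢ 𝓝[≠] (0 : ℂ) ≤ 𝓝 (0, 0) := by
    rw [nhds_prod_eq]
    exact prod_mono nhdsWithin_le_nhds nhdsWithin_le_nhds
  refine hle (ContinuousAt.eventually_ne ?_ ?_)
  · have hx := (differentiableAt_centred hφ ha).continuousAt
    have hy := (differentiableAt_centred hφ hb).continuousAt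
    have hxy : ContinuousAt (fun p : ℂ × ℂ => centred φ a p.1 * centred φ b p.2) (0, 0) :=
      (hx.comp' (f := Prod.fst) continuousAt_fst).mul (hy.comp' (f := Prod.snd) continuousAt_snd)
    exact continuousAt_const.add (φ.continuous.continuousAt.comp' hxy)
  · simp [centred_zero hφ ha]

namespace IsBiFree

variable {a b : Fin 2 → A}

theorem eventually_chi_mul_left (h : IsBiFree.{0, v, w} (φ : A →ₗ[ℂ] ℂ) a b)
    (ha : ∀ k, φ (a k) ≠ 0) :
    ∀ᶠ z in 𝓝[≠] 0,
      chi φ (a 0 * a 1) z = (z + 1) / z * (chi φ (a 0) z * chi φ (a 1) z) := by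
  refine eventually_chi_mul h.map_one ha ?_ fun z hz => ?_
  · exact (h.map_mul_left (by decide)).trans_ne (mul_ne_zero (ha 0) (ha 1))
  · refine CentredBiFree.map_altResolvent_left ?_ hz.norm_smul_lt_one
    exact h.centredBiFree (fun k => (hz.isRegularPoint k).centred_mem_elemental)
      (fun _ => zero_mem _) (fun k => (hz.isRegularPoint k).map_centred h.map_one)
      (fun _ => map_zero φ)

theorem eventually_chi_mul_right (h : IsBiFree.{0, v, w} (φ : A →ₗ[ℂ] ℂ) a b)
    (hb : ∀ k, φ (b k) ≠ 0) :
    ∀ᶠ w in 𝓝[≠] 0,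
      chi φ (b 0 * b 1) w = (w + 1) / w * (chi φ (b 0) w * chi φ (b 1) w) := by
  refine eventually_chi_mul h.map_one hb ?_ fun z hz => ?_
  · exact (h.map_mul_right (by decide)).trans_ne (mul_ne_zero (hb 0) (hb 1))
  · refine CentredBiFree.map_altResolvent_right ?_ hz.norm_smul_lt_one
    exact h.centredBiFree (fun _ => zero_mem _)
      (fun k => (hz.isRegularPoint k).centred_mem_elemental) (fun _ => map_zero φ)
      (fun k => (hz.isRegularPoint k).map_centred h.map_one)

theorem HFun_chi_mul (h : IsBiFree.{0, v, w} (φ : A →ₗ[ℂ] ℂ) a b) {z w : ℂ}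
    (hz : IsRegularPair φ a z) (hw : IsRegularPair φ b w)
    (hchi_z : chi φ (a 0 * a 1) z = (z + 1) / z * (chi φ (a 0) z * chi φ (a 1) z))
    (hchi_w : chi φ (b 0 * b 1) w = (w + 1) / w * (chi φ (b 0) w * chi φ (b 1) w)) :
    HFun φ (a 0 * a 1) (b 0 * b 1) (chi φ (a 0 * a 1) z) (chi φ (b 0 * b 1) w) =
      (1 + z) * (1 + w) *
        ((1 + φ (centred φ (a 0) z * centred φ (b 0) w)) *
            (1 + φ (centred φ (a 1) z * centred φ (b 1) w)) /
          (1 - (z + 1) / z * ((w + 1) / w) * (φ (centred φ (a 0) z * centred φ (b 0) w) *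
            φ (centred φ (a 1) z * centred φ (b 1) w)))) := by
  have hcentred : CentredBiFree φ (fun k => centred φ (a k) z) (fun k => centred φ (b k) w) :=
    h.centredBiFree (fun k => (hz.isRegularPoint k).centred_mem_elemental)
      (fun k => (hw.isRegularPoint k).centred_mem_elemental)
      (fun k => (hz.isRegularPoint k).map_centred h.map_one)
      (fun k => (hw.isRegularPoint k).map_centred h.map_one)
  rw [HFun, hchi_z, hchi_w, hz.inverse_eq, hw.inverse_eq, smul_mul_smul_comm, map_smul,
    smul_eq_mul, hcentred.map_altResolvent_mul_altResolvent hz.norm_smul_lt_one hw.norm_smul_lt_one]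

theorem eventually_partialS_mul (h : IsBiFree.{0, v, w} (φ : A →ₗ[ℂ] ℂ) a b)
    (ha : ∀ k, φ (a k) ≠ 0) (hb : ∀ k, φ (b k) ≠ 0) :
    ∀ᶠ p : ℂ × ℂ in 𝓝[≠] 0 ×ˢ 𝓝[≠] 0, partialS φ (a 0 * a 1) (b 0 * b 1) p.1 p.2 =
      partialS φ (a 0) (b 0) p.1 p.2 * partialS φ (a 1) (b 1) p.1 p.2 := by
  have hφ : φ 1 = 1 := h.map_one
  filter_upwards [(eventually_isRegularPair hφ ha).prod_mk (eventually_isRegularPair hφ hb),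
    (h.eventually_chi_mul_left ha).prod_mk (h.eventually_chi_mul_right hb),
    eventually_one_add_map_centred_mul_ne_zero hφ (ha 0) (hb 0),
    eventually_one_add_map_centred_mul_ne_zero hφ (ha 1) (hb 1)]
    with ⟨z, w⟩ ⟨hz, hw⟩ ⟨hchi_z, hchi_w⟩ hg₀ hg₁
  have hS {c d : A} {κ : ℂ}
      (hH : HFun φ c d (chi φ c z) (chi φ d w) = (1 + z) * (1 + w) * κ) :=
    partialS_eq_of_HFun_eq hz.ne_zero hw.ne_zero (hz.isRegularPoint 0).one_add_ne_zero
      (hw.isRegularPoint 0).one_add_ne_zero hH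
  simp only [hS (h.HFun_chi_mul hz hw hchi_z hchi_w),
    hS (HFun_chi_chi hφ (hz.isRegularPoint _) (hw.isRegularPoint _)), div_div_eq_mul_div]
  field_simp
  ring

end IsBiFree

end STransform

end

end BiFree

theorem theorem2p1 {A : Type w} [NormedRing A] [NormedAlgebra ℂ A] [CompleteSpace A]
    (φ : A →L[ℂ] ℂ) (hφ : φ 1 = 1) (a₁ a₂ b₁ b₂ : A)
    (hfree : BiFree.IsBiFree.{0, v, w} (φ : A →ₗ[ℂ] ℂ) ![a₁, a₂] ![b₁, b₂])
    (ha₁ : φ a₁ ≠ 0) (ha₂ : φ a₂ ≠ 0) (hb₁ : φ b₁ ≠ 0) (hb₂ : φ b₂ ≠ 0) :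
    φ (a₁ * a₂) ≠ 0 ∧ φ (b₁ * b₂) ≠ 0 ∧
      ∀ᶠ p : ℂ × ℂ in nhds (0, 0), p.1 ≠ 0 → p.2 ≠ 0 →
        BiFree.partialS φ (a₁ * a₂) (b₁ * b₂) p.1 p.2 =
          BiFree.partialS φ a₁ b₁ p.1 p.2 * BiFree.partialS φ a₂ b₂ p.1 p.2 := by
  have ha : ∀ k, φ (![a₁, a₂] k) ≠ 0 := Fin.forall_fin_two.2 ⟨ha₁, ha₂⟩
  have hb : ∀ k, φ (![b₁, b₂] k) ≠ 0 := Fin.forall_fin_two.2 ⟨hb₁, hb₂⟩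
  have hmul_a : φ (a₁ * a₂) = φ a₁ * φ a₂ := hfree.map_mul_left (i := 0) (j := 1) (by decide)
  have hmul_b : φ (b₁ * b₂) = φ b₁ * φ b₂ := hfree.map_mul_right (i := 0) (j := 1) (by decide)
  refine ⟨hmul_a ▸ mul_ne_zero ha₁ ha₂, hmul_b ▸ mul_ne_zero hb₁ hb₂, ?_⟩
  have hS := hfree.eventually_partialS_mul ha hb
  rw [← nhdsWithin_prod_eq, eventually_nhdsWithin_iff] at hS
  filter_upwards [hS] with p hp hz hw
  exact hp ⟨hz, hw⟩
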